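/- Let $\Omega$ be a finite set of states, $M$ a finite set of outcomes, $L=\Delta(M)$ the set of lotteries on $M$, and $O$ an extra outcome. An event is a nonempty subset of $\Omega$. For $l\in L$ and an event $A$, the conditional constant act $(l,A,O,A^c)$ is the function on $\Omega$ that equals $l$ on $A$ and $O$ on $A^c=\Omega\setminus A$. Let $\succcurlyeq$ be a (not necessarily complete) binary relation on the set of conditional constant acts. For an event $A$ and $x,y\in L$ write $x\succcurlyeq_A y$ if $(x,A,O,A^c)\succcurlyeq(y,A,O,A^c)$, write $x\succ_A y$ if $x\succcurlyeq_A y$ and not $y\succcurlyeq_A x$, and write $\succcurlyeq_\omega,\succ_\omega$ for $\succcurlyeq_{\{\omega\}},\succ_{\{\omega\}}$. Suppose that the following six axioms hold. 1. (Weak Order) For every event $A$, $\succcurlyeq_A$ is complete and transitive. 2. (vN-M Continuity) For every event $A$ and all $x,y,z\in L$ with $x\succ_A y\succ_A z$ there are $\alpha,\beta\in(0,1)$ such that $\alpha x+(1-\alpha)z\succcurlyeq_A y\succcurlyeq_A\beta x+(1-\beta)z$. 3. (Independence) For every event $A$, all $x,y,z\in L$ and every $\alpha\in(0,1)$: $x\succcurlyeq_A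 y\iff \alpha x+(1-\alpha)z\succcurlyeq_A\alpha y+(1-\alpha)z$. 4. (Extended Pareto) For all disjoint events $A,B$ and all $x,y\in L$: if $x\succcurlyeq_A y$ and $x\succcurlyeq_B y$ then $x\succcurlyeq_{A\cup B}y$; and if $x\succ_A y$ and $x\succcurlyeq_B y$ then $x\succ_{A\cup B}y$. 5. (Minimal Agreement) There are $\overline{x},\underline{x}\in L$ such that $\overline{x}\succ_\omega\underline{x}$ for every $\omega\in\Omega$. 6. (Richness) There are three distinct states $\omega_1,\omega_2,\omega_3\in\Omega$ such that for every $\omega\in\{\omega_1,\omega_2,\omega_3\}$ there are $x,y\in L$ with $x\succ_\omega y$ and $y\succcurlyeq_{\omega'}x$ for both $\omega'\in\{\omega_1,\omega_2,\omega_3\}\setminus\{\omega\}$. Then there are a function $u:\Omega\times M\to\mathbb{R}$ and a probability measure $P$ on $\Omega$ with $P(\omega)>0$ for every $\omega\in\Omega$, such that for all $x,y\in L$ and every event $A$, $$x\succcurlyeq_A y\iff\sum_{\omega\in A}P(\omega|A)\,E^x[u(\omega,\cdot)]\ \ge\ \sum_{\omega\in A}P(\omega|A)\,E^y[u(\omega,\cdot)],$$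 where $P(\omega|A)=P(\omega)/P(A)$ for $\omega\in A$, and $E^x[u(\omega,\cdot)]=\sum_{m\in M}x(m)\,u(\omega,m)$. -/

import Mathlib

noncomputable section

namespace CondSEU

/-- The lotteries `Δ(M)` over a finite set `M` of outcomes. -/
abbrev Lottery (M : Type*) [Fintype M] : Type _ := {l : M → ℝ // l ∈ stdSimplex ℝ M}

/-- The mixture `α x + (1 - α) y` of two lotteries, for `α ∈ (0, 1)`. -/
def mix {M : Type*} [Fintype M] (α : Set.Ioo (0 : ℝ) 1) (x y : Lottery M) : Lottery M :=
  ⟨fun m => (α : ℝ) * x.1 m + (1 - (α : ℝ)) * y.1 m,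
    convex_stdSimplex ℝ M x.2 y.2 α.2.1.le (sub_nonneg.2 α.2.2.le) (add_sub_cancel _ _)⟩

/-- The events: the nonempty sets of states. -/
abbrev Event (Ω : Type*) : Type _ := {A : Finset Ω // A.Nonempty}

/-- The event `{ω}`. -/
def Event.single {Ω : Type*} (ω : Ω) : Event Ω := ⟨{ω}, Finset.singleton_nonempty ω⟩

/-- The union of two events. -/
def Event.union {Ω : Type*} [DecidableEq Ω] (A B : Event Ω) : Event Ω :=
  ⟨A.1 ∪ B.1, A.2.mono Finset.subset_union_left⟩

/-- The function `(l, A, O, Aᶜ)` on the states: it is the lottery `l` on `A`, and the extra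
outcome `O` (here `none`) outside `A`. -/
def actFun {Ω M : Type*} [DecidableEq Ω] [Fintype M] (l : Lottery M) (A : Event Ω) :
    Ω → Option (Lottery M) :=
  fun ω => if ω ∈ A.1 then some l else none

/-- The set `F` of conditional constant acts. -/
abbrev CondAct (Ω M : Type*) [DecidableEq Ω] [Fintype M] : Type _ :=
  {f : Ω → Option (Lottery M) // ∃ (l : Lottery M) (A : Event Ω), f = actFun l A}

/-- The conditional constant act `(l, A, O, Aᶜ)`. -/
def act {Ω M : Type*} [DecidableEq Ω] [Fintype M] (l : Lottery M) (A : Event Ω) : CondAct Ω M :=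
  ⟨actFun l A, l, A, rfl⟩

section Axioms

variable {Ω M : Type*} [DecidableEq Ω] [Fintype M]

/-- The conditional preference `x ≽_A y` induced by a preference relation on conditional
constant acts: `(x, A, O, Aᶜ) ≽ (y, A, O, Aᶜ)`. -/
def Pref (R : CondAct Ω M → CondAct Ω M → Prop) (A : Event Ω) (x y : Lottery M) : Prop :=
  R (act x A) (act y A)

/-- The strict part `x ≻_A y` of the conditional preference. -/
def SPref (R : CondAct Ω M → CondAct Ω M → Prop) (A : Event Ω) (x y : Lottery M) : Prop :=
  Pref R A x y ∧ ¬ Pref R A y x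

/-- Every conditional preference is complete and transitive. -/
def WeakOrder (R : CondAct Ω M → CondAct Ω M → Prop) : Prop :=
  ∀ A : Event Ω, (∀ x y : Lottery M, Pref R A x y ∨ Pref R A y x) ∧
    ∀ x y z : Lottery M, Pref R A x y → Pref R A y z → Pref R A x z

/-- The Archimedean axiom of von Neumann and Morgenstern for every conditional preference. -/
def VNMContinuity (R : CondAct Ω M → CondAct Ω M → Prop) : Prop :=
  ∀ (A : Event Ω) (x y z : Lottery M), SPref R A x y → SPref R A y z →
    ∃ α β : Set.Ioo (0 : ℝ) 1, Pref R A (mix α x z) y ∧ Pref R A y (mix β x z)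

/-- The independence axiom of von Neumann and Morgenstern for every conditional preference. -/
def Independence (R : CondAct Ω M → CondAct Ω M → Prop) : Prop :=
  ∀ (A : Event Ω) (x y z : Lottery M) (α : Set.Ioo (0 : ℝ) 1),
    Pref R A x y ↔ Pref R A (mix α x z) (mix α y z)

/-- The extended Pareto axiom, weak and strict part. -/
def ExtendedPareto (R : CondAct Ω M → CondAct Ω M → Prop) : Prop :=
  ∀ A B : Event Ω, Disjoint A.1 B.1 → ∀ x y : Lottery M,
    (Pref R A x y → Pref R B x y → Pref R (A.union B) x y) ∧
    (SPref R A x y → Pref R B x y → SPref R (A.union B) x y)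

/-- Two lotteries are strictly ranked in the same way in every state. -/
def MinimalAgreement (R : CondAct Ω M → CondAct Ω M → Prop) : Prop :=
  ∃ xbar xlow : Lottery M, ∀ ω : Ω, SPref R (Event.single ω) xbar xlow

/-- There are three (distinct) states such that for each `ω` of them some `x, y` have `x ≻_ω y`
while `y ≽_ω' x` in the two other states `ω'`. -/
def Richness (R : CondAct Ω M → CondAct Ω M → Prop) : Prop :=
  ∃ T : Finset Ω, T.card = 3 ∧ ∀ ω ∈ T, ∃ x y : Lottery M,
    SPref R (Event.single ω) x y ∧ ∀ ω' ∈ T \ {ω}, Pref R (Event.single ω') y x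

end Axioms

/-- The expected utility `E^x[v]` of `v : M → ℝ` under the lottery `x`. -/
def expUtil {M : Type*} [Fintype M] (x : Lottery M) (v : M → ℝ) : ℝ := ∑ m, x.1 m * v m

/-- The conditional probability `P(ω | A) = P({ω} ∩ A) / P(A)`. -/
def condProb {Ω : Type*} [DecidableEq Ω] (P : Ω → ℝ) (A : Event Ω) (ω : Ω) : ℝ :=
  (∑ ω' ∈ {ω} ∩ A.1, P ω') / ∑ ω' ∈ A.1, P ω'

/-- The conditional expected utility `∑_{ω ∈ A} P(ω | A) E^x[u(ω, ·)]`. -/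
def condExpUtil {Ω M : Type*} [DecidableEq Ω] [Fintype M] (P : Ω → ℝ) (u : Ω → M → ℝ)
    (A : Event Ω) (x : Lottery M) : ℝ :=
  ∑ ω ∈ A.1, condProb P A ω * expUtil x (u ω)

end CondSEU

end

namespace CondSEU

/-! ### Expected utility for one preference, and Harsanyi aggregation of two. -/

section VNM

variable {M : Type*} [Fintype M] {Q : Lottery M → Lottery M → Prop}

/-! By von Neumann–Morgenstern (`exists_expected_utility`), each conditional preference is
represented by a linear functional `F A`. Minimal agreement supplies two lotteries `x₀`, `x₁` at
which every `F A` can be normalized to 0 and 1. Extended Pareto then becomes Harsanyi's theorem for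
two agents (`exists_convex_combination`): for disjoint events, `F (A ∪ B)` lies in the open segment
between `F A` and `F B`.

What remains is geometry (`exists_weights`): a single positive weight function must make every `F A`
the barycentre of the points `F {ω}`. Richness makes three of these points linearly independent
(`indep3_of_isolated`). In a nondegenerate triangle the three pairs have consistent weights, as in
Ceva's theorem, and ratios of weights pass through such triangles to all pairs of states. Larger
sets follow by induction on cardinality: if `F A` is not the barycentre although it is on the parts
of `A`, then point values are forced into a plane, which three independent vectors forbid.

Normalizing the weights gives `P`, and `F {ω}` evaluated at degenerate lotteries gives `u ω`. -/

theorem mix_symm (α : Set.Ioo (0 : ℝ) 1) (x y : Lottery M) :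
    mix ⟨1 - α, sub_pos.2 α.2.2, sub_lt_self _ α.2.1⟩ y x = mix α x y := by
  apply Subtype.ext
  funext m
  simp only [mix]
  ring

theorem mix_val (α : Set.Ioo (0 : ℝ) 1) (x y : Lottery M) :
    (mix α x y).1 = (α : ℝ) • x.1 + (1 - (α : ℝ)) • y.1 := rfl

/-- The independence axiom for a relation on lotteries. -/
def MixIndependent (Q : Lottery M → Lottery M → Prop) : Prop :=
  ∀ (x y z : Lottery M) (α : Set.Ioo (0 : ℝ) 1), Q x y ↔ Q (mix α x z) (mix α y z)

theorem MixIndependent.right (hind : MixIndependent Q) (x y z : Lottery M)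
    (α : Set.Ioo (0 : ℝ) 1) : Q x y ↔ Q (mix α z x) (mix α z y) := by
  rw [← mix_symm α z x, ← mix_symm α z y]
  exact hind x y z _

/-- Whether `x` is weakly preferred to `y` depends on the direction of `x - y` only. -/
theorem MixIndependent.of_smul_sub_eq (hind : MixIndependent Q) {x y x' y' : Lottery M} {s t : ℝ}
    (hs : 0 < s) (ht : 0 < t) (H : s • (x.1 - y.1) = t • (x'.1 - y'.1)) (hxy : Q x y) :
    Q x' y' := by
  have hst : 0 < s + t := add_pos hs ht
  -- With this `α` the mixtures of `x` with `y'` and of `y` with `x'` coincide. Independence is then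
  -- used twice: to mix `y'` into the given comparison, and to cancel `y` from the result.
  let α : Set.Ioo (0 : ℝ) 1 := ⟨s / (s + t), by positivity, by rw [div_lt_one hst]; linarith⟩
  have e : mix α x y' = mix α y x' := by
    apply Subtype.ext
    rw [mix_val, mix_val]
    have h1 : (1 - (α : ℝ)) = t / (s + t) := by
      simp only [α]; field_simp; ring
    have h2 : (α : ℝ) = s / (s + t) := rfl
    rw [h1, h2, ← sub_eq_zero]
    rw [← sub_eq_zero] at H
    rw [← smul_zero ((s + t)⁻¹), ← H]
    module
  have := (hind x y y' α).1 hxy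
  rw [e] at this
  exact (hind.right x' y' y α).2 this

/-- The directions of weak improvement. -/
def IsPrefDir (Q : Lottery M → Lottery M → Prop) (d : M → ℝ) : Prop :=
  ∃ t : ℝ, 0 < t ∧ ∃ x y : Lottery M, Q x y ∧ d = t • (x.1 - y.1)

theorem isPrefDir_sub_iff (hind : MixIndependent Q) {x y : Lottery M} :
    IsPrefDir Q (x.1 - y.1) ↔ Q x y := by
  constructor
  · rintro ⟨t, ht, x', y', h', e⟩
    exact hind.of_smul_sub_eq ht one_pos (by rw [one_smul, e]) h'
  · exact fun h' ↦ ⟨1, one_pos, x, y, h', by rw [one_smul]⟩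

theorem IsPrefDir.smul {d : M → ℝ} (h : IsPrefDir Q d) {c : ℝ} (hc : 0 < c) :
    IsPrefDir Q (c • d) := by
  obtain ⟨t, ht, x, y, hxy, rfl⟩ := h
  exact ⟨c * t, by positivity, x, y, hxy, smul_smul _ _ _⟩

theorem IsPrefDir.add (htrans : ∀ x y z, Q x y → Q y z → Q x z) (hind : MixIndependent Q)
    {d d' : M → ℝ} (h : IsPrefDir Q d) (h' : IsPrefDir Q d') : IsPrefDir Q (d + d') := by
  obtain ⟨t, ht, x, y, hxy, rfl⟩ := h
  obtain ⟨t', ht', x', y', hxy', rfl⟩ := h'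
  have hst : 0 < t + t' := add_pos ht ht'
  let α : Set.Ioo (0 : ℝ) 1 := ⟨t / (t + t'), by positivity, by rw [div_lt_one hst]; linarith⟩
  refine ⟨t + t', hst, mix α x x', mix α y y',
    htrans _ _ _ ((hind x y x' α).1 hxy) ((hind.right x' y' y α).1 hxy'), ?_⟩
  rw [mix_val, mix_val]
  have h2 : (α : ℝ) = t / (t + t') := rfl
  rw [h2]
  match_scalars <;> field_simp <;> ring

theorem lottery_sum (x : Lottery M) : ∑ m, x.1 m = 1 := x.2.2

theorem Lottery.nonempty (x : Lottery M) : Nonempty M := by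
  by_contra h
  rw [not_nonempty_iff] at h
  simpa using lottery_sum x

/-- The uniform lottery is in the relative interior of the set of lotteries. -/
theorem exists_interior_lottery [Nonempty M] :
    ∃ c : Lottery M, ∀ d : M → ℝ, ∑ m, d m = 0 →
      ∃ T : ℝ, 0 < T ∧ ∀ t, T ≤ t → ∃ x : Lottery M, x.1 = c.1 + t⁻¹ • d := by
  have hn : (0 : ℝ) < Fintype.card M := by exact_mod_cast Fintype.card_pos
  -- The bound ensures `card M * |d m| ≤ t`, so no coordinate becomes negative; the summand 1 keeps
  -- it positive when `d = 0`.
  refine ⟨⟨fun _ ↦ (Fintype.card M : ℝ)⁻¹, fun _ ↦ by positivity, by simp [hn.ne']⟩,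
    fun d hd ↦ ⟨Fintype.card M * ∑ m, |d m| + 1, by positivity, fun t ht ↦ ?_⟩⟩
  have hS : 0 ≤ ∑ m, |d m| := by positivity
  have ht0 : 0 < t := lt_of_lt_of_le (by positivity) ht
  refine ⟨⟨fun m ↦ (Fintype.card M : ℝ)⁻¹ + t⁻¹ * d m, fun m ↦ ?_, ?_⟩, rfl⟩
  · have h1 : |d m| ≤ ∑ m, |d m| :=
      Finset.single_le_sum (f := fun m ↦ |d m|) (fun _ _ ↦ abs_nonneg _) (Finset.mem_univ m)
    have h2 := neg_abs_le (d m)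
    have h3 : 0 ≤ t + Fintype.card M * d m := by nlinarith
    have h4 : (Fintype.card M : ℝ)⁻¹ + t⁻¹ * d m
        = (t + Fintype.card M * d m) * ((Fintype.card M : ℝ)⁻¹ * t⁻¹) := by field_simp
    change 0 ≤ (Fintype.card M : ℝ)⁻¹ + t⁻¹ * d m
    rw [h4]
    positivity
  · rw [Finset.sum_add_distrib, ← Finset.mul_sum, hd]
    simp [hn.ne']

/-- The Archimedean axiom for directions. Small steps from an interior lottery `c` along `d` and
`-d'` give lotteries strictly above and below `c`; continuity yields a mixture weakly above `c`,
that is, the direction `α d - (1 - α) d'`, which is divided by `1 - α`. -/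
theorem exists_smul_sub_isPrefDir (htot : ∀ x y, Q x y ∨ Q y x)
    (hcont : ∀ x y z, Q x y ∧ ¬ Q y x → Q y z ∧ ¬ Q z y →
      ∃ α : Set.Ioo (0 : ℝ) 1, Q (mix α x z) y)
    [Nonempty M] {d d' : M → ℝ} (hd : ∑ m, d m = 0) (hd' : ∑ m, d' m = 0)
    (h : ¬ IsPrefDir Q (-d)) (h' : ¬ IsPrefDir Q (-d')) :
    ∃ r : ℝ, 0 < r ∧ IsPrefDir Q (r • d - d') := by
  obtain ⟨c, hc⟩ := exists_interior_lottery (M := M)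
  obtain ⟨T, hT, H⟩ := hc d hd
  obtain ⟨T', hT', H'⟩ := hc (-d') (by simp [hd'])
  set t := max T T'
  have ht : 0 < t := lt_max_of_lt_left hT
  obtain ⟨x, hx⟩ := H t (le_max_left _ _)
  obtain ⟨z, hz⟩ := H' t (le_max_right _ _)
  have h1 : ¬ Q c x := fun hq ↦ h ⟨t, ht, c, x, hq, by
    rw [hx, sub_add_cancel_left, smul_neg, smul_inv_smul₀ ht.ne']⟩
  have h2 : ¬ Q z c := fun hq ↦ h' ⟨t, ht, z, c, hq, by
    rw [hz, add_sub_cancel_left, smul_inv_smul₀ ht.ne']⟩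
  obtain ⟨α, hα⟩ := hcont x c z ⟨(htot x c).resolve_right h1, h1⟩ ⟨(htot c z).resolve_right h2, h2⟩
  have a0 := α.2.1
  have a1 : 0 < 1 - (α : ℝ) := sub_pos.2 α.2.2
  refine ⟨α / (1 - α), by positivity, t / (1 - α), by positivity, _, _, hα, ?_⟩
  rw [mix_val, hx, hz]
  match_scalars <;> field_simp <;> ring

/-- The projection to the vectors with sum zero along the lottery `x₀`. -/
def sumZeroProj (x₀ : Lottery M) : (M → ℝ) →ₗ[ℝ] (M → ℝ) where
  toFun w := w - (∑ m, w m) • x₀.1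
  map_add' v w := by
    simp only [Pi.add_apply, Finset.sum_add_distrib]; module
  map_smul' c w := by
    simp only [Pi.smul_apply, smul_eq_mul, ← Finset.mul_sum, RingHom.id_apply]; module

theorem sumZeroProj_apply (x₀ : Lottery M) (w : M → ℝ) :
    sumZeroProj x₀ w = w - (∑ m, w m) • x₀.1 := rfl

theorem sum_sumZeroProj (x₀ : Lottery M) (w : M → ℝ) : ∑ m, sumZeroProj x₀ w m = 0 := by
  simp [sumZeroProj_apply, Finset.sum_sub_distrib, ← Finset.mul_sum, lottery_sum x₀]

theorem sumZeroProj_of_sum_eq_zero (x₀ : Lottery M) {w : M → ℝ} (hw : ∑ m, w m = 0) :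
    sumZeroProj x₀ w = w := by
  simp [sumZeroProj_apply, hw]

theorem sumZeroProj_self (x₀ : Lottery M) : sumZeroProj x₀ x₀.1 = 0 := by
  simp [sumZeroProj_apply, lottery_sum x₀]

theorem sum_sub_lottery (x y : Lottery M) : ∑ m, (x.1 - y.1) m = 0 := by
  simp [Finset.sum_sub_distrib, lottery_sum]

/-- **The von Neumann–Morgenstern theorem**: a complete, transitive, Archimedean and independent
relation on lotteries has an expected utility representation, normalized at two given lotteries. -/
theorem exists_expected_utility (htot : ∀ x y, Q x y ∨ Q y x)
    (htrans : ∀ x y z, Q x y → Q y z → Q x z)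
    (hcont : ∀ x y z, Q x y ∧ ¬ Q y x → Q y z ∧ ¬ Q z y →
      ∃ α : Set.Ioo (0 : ℝ) 1, Q (mix α x z) y)
    (hind : MixIndependent Q) {x₁ x₀ : Lottery M} (h₁ : ¬ Q x₀ x₁) :
    ∃ g : (M → ℝ) →ₗ[ℝ] ℝ, g x₀.1 = 0 ∧ g x₁.1 = 1 ∧ ∀ x y, Q x y ↔ g y.1 ≤ g x.1 := by
  have : Nonempty M := x₀.nonempty
  set e := x₁.1 - x₀.1 with he
  have hes : ∑ m, e m = 0 := sum_sub_lottery _ _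
  have hneg : ¬ IsPrefDir Q (-e) := by
    rw [he, neg_sub, isPrefDir_sub_iff hind]; exact h₁
  have hzero : IsPrefDir Q 0 := ⟨1, one_pos, x₀, x₀, (htot _ _).elim id id, by simp⟩
  have he0 : e ≠ 0 := fun h ↦ hneg (by rw [h, neg_zero]; exact hzero)
  -- Pulling back along the projection puts the whole line of `x₀` into the cone, so a functional
  -- nonnegative on it vanishes at `x₀`.
  let K : PointedCone ℝ (M → ℝ) :=
    { carrier := {w | IsPrefDir Q (sumZeroProj x₀ w)}
      add_mem' := fun {a b} ha hb ↦ by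
        simp only [Set.mem_ofPred_eq, map_add] at *
        exact ha.add htrans hind hb
      zero_mem' := by simpa using hzero
      smul_mem' := fun c w hw ↦ by
        simp only [Set.mem_ofPred_eq] at *
        rcases eq_or_lt_of_le c.2 with h0 | h0
        · have : c = 0 := Subtype.ext h0.symm
          simpa [this] using hzero
        · have := hw.smul h0
          rwa [← map_smul] at this }
  have hK : ∀ w, w ∈ K ↔ IsPrefDir Q (sumZeroProj x₀ w) := fun _ ↦ Iff.rfl
  -- The functional `c • e ↦ c` is extended from the line of `e`. It is nonnegative on `K` because
  -- `-e` is not an improvement; cofinality of the line is the Archimedean property.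
  obtain ⟨g, hg, hgK⟩ := riesz_extension K
    (LinearPMap.mkSpanSingleton (K := ℝ) (L := ℝ) (σ := RingHom.id ℝ) e (1 : ℝ) he0)
    (by
      rintro ⟨w, hw⟩ hwK
      obtain ⟨c, rfl⟩ := Submodule.mem_span_singleton.1 hw
      rw [LinearPMap.mkSpanSingleton'_apply]
      by_contra hc
      have hc' : c < 0 := by simpa using hc
      apply hneg
      have h2 : IsPrefDir Q (sumZeroProj x₀ (c • e)) := hwK
      rw [map_smul, sumZeroProj_of_sum_eq_zero x₀ hes] at h2
      have h3 := h2.smul (c := -c⁻¹) (by simpa using hc')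
      rwa [neg_smul, inv_smul_smul₀ hc'.ne] at h3)
    (by
      intro w
      by_cases hw : w ∈ K
      · exact ⟨0, by simpa using hw⟩
      · obtain ⟨r, -, hr⟩ := exists_smul_sub_isPrefDir htot hcont hes
          (d' := -sumZeroProj x₀ w) (by simpa using sum_sumZeroProj x₀ w) hneg (by
            rwa [neg_neg])
        refine ⟨⟨r • e, Submodule.mem_span_singleton.2 ⟨r, rfl⟩⟩, ?_⟩
        rw [hK, map_add, map_smul, sumZeroProj_of_sum_eq_zero x₀ hes]
        rwa [sub_neg_eq_add] at hr)
  have hge : g e = 1 := by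
    have := hg ⟨e, Submodule.mem_span_singleton_self e⟩
    rwa [LinearPMap.mkSpanSingleton_apply] at this
  have hg0 : g x₀.1 = 0 := by
    apply le_antisymm
    · have := hgK (-x₀.1) (by rw [hK, map_neg, sumZeroProj_self, neg_zero]; exact hzero)
      rw [map_neg] at this
      linarith
    · exact hgK _ (by rw [hK, sumZeroProj_self]; exact hzero)
  refine ⟨g, hg0, by rw [he, map_sub, hg0] at hge; linarith, fun x y ↦ ?_⟩
  constructor
  · intro hxy
    have := hgK (x.1 - y.1) (by
      rw [hK, sumZeroProj_of_sum_eq_zero _ (sum_sub_lottery _ _), isPrefDir_sub_iff hind]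
      exact hxy)
    rw [map_sub] at this
    linarith
  · intro hxy
    by_contra hq
    -- A strict improvement has a positive multiple that still exceeds `e`, so its utility gain is
    -- bounded away from zero.
    obtain ⟨r, hr, hd⟩ := exists_smul_sub_isPrefDir htot hcont (sum_sub_lottery y x) hes
      (by rwa [neg_sub, isPrefDir_sub_iff hind]) hneg
    have := hgK (r • (y.1 - x.1) - e) (by
      rw [hK, map_sub, map_smul, sumZeroProj_of_sum_eq_zero _ (sum_sub_lottery _ _),
        sumZeroProj_of_sum_eq_zero _ hes]
      exact hd)
    rw [map_sub, map_smul, map_sub, hge, smul_eq_mul] at this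
    nlinarith

/-- **Harsanyi's theorem** for two expected utilities that agree in strictly ranking `x₁` above
`x₀`. -/
theorem exists_convex_combination {x₁ x₀ : Lottery M} {f g k : (M → ℝ) →ₗ[ℝ] ℝ}
    (hf₀ : f x₀.1 = 0) (hg₀ : g x₀.1 = 0) (hk₀ : k x₀.1 = 0)
    (hf₁ : f x₁.1 = 1) (hg₁ : g x₁.1 = 1) (hk₁ : k x₁.1 = 1)
    (hweak : ∀ x y : Lottery M, f y.1 ≤ f x.1 → g y.1 ≤ g x.1 → k y.1 ≤ k x.1)
    (hfg : ∀ x y : Lottery M, f y.1 < f x.1 → g y.1 ≤ g x.1 → k y.1 < k x.1)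
    (hgf : ∀ x y : Lottery M, f y.1 ≤ f x.1 → g y.1 < g x.1 → k y.1 < k x.1) :
    ∃ s : ℝ, 0 < s ∧ s < 1 ∧ k = s • f + (1 - s) • g := by
  have : Nonempty M := x₀.nonempty
  obtain ⟨c, hc⟩ := exists_interior_lottery (M := M)
  -- Together with `proj`, this transfers the Pareto conditions from pairs of lotteries to all
  -- vectors.
  have real : ∀ w : M → ℝ, ∑ m, w m = 0 → ∃ t : ℝ, 0 < t ∧ ∃ x y : Lottery M,
      w = t • (x.1 - y.1) := by
    intro w hw
    obtain ⟨T, hT, H⟩ := hc w hw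
    obtain ⟨x, hx⟩ := H T le_rfl
    exact ⟨T, hT, x, c, by rw [hx, add_sub_cancel_left, smul_inv_smul₀ hT.ne']⟩
  have proj : ∀ l : (M → ℝ) →ₗ[ℝ] ℝ, l x₀.1 = 0 → ∀ w, l (sumZeroProj x₀ w) = l w := by
    intro l hl w
    simp [sumZeroProj_apply, hl]
  have lin : ∀ (l : (M → ℝ) →ₗ[ℝ] ℝ) (t : ℝ) (x y : Lottery M),
      l (t • (x.1 - y.1)) = t * (l x.1 - l y.1) := by
    intro l t x y; rw [map_smul, map_sub, smul_eq_mul]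
  have nonneg : ∀ w : M → ℝ, 0 ≤ f w → 0 ≤ g w → 0 ≤ k w := by
    intro w hfw hgw
    rw [← proj f hf₀] at hfw
    rw [← proj g hg₀] at hgw
    rw [← proj k hk₀]
    obtain ⟨t, ht, x, y, e⟩ := real _ (sum_sumZeroProj x₀ w)
    rw [e, lin] at hfw hgw ⊢
    have a1 := nonneg_of_mul_nonneg_right hfw ht
    have a2 := nonneg_of_mul_nonneg_right hgw ht
    have := hweak x y (by linarith) (by linarith)
    exact mul_nonneg ht.le (by linarith)
  have pos₁ : ∀ w : M → ℝ, 0 < f w → 0 ≤ g w → 0 < k w := by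
    intro w hfw hgw
    rw [← proj f hf₀] at hfw
    rw [← proj g hg₀] at hgw
    rw [← proj k hk₀]
    obtain ⟨t, ht, x, y, e⟩ := real _ (sum_sumZeroProj x₀ w)
    rw [e, lin] at hfw hgw ⊢
    have a1 := pos_of_mul_pos_right hfw ht.le
    have a2 := nonneg_of_mul_nonneg_right hgw ht
    have := hfg x y (by linarith) (by linarith)
    exact mul_pos ht (by linarith)
  have pos₂ : ∀ w : M → ℝ, 0 ≤ f w → 0 < g w → 0 < k w := by
    intro w hfw hgw
    rw [← proj f hf₀] at hfw
    rw [← proj g hg₀] at hgw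
    rw [← proj k hk₀]
    obtain ⟨t, ht, x, y, e⟩ := real _ (sum_sumZeroProj x₀ w)
    rw [e, lin] at hfw hgw ⊢
    have a1 := nonneg_of_mul_nonneg_right hfw ht
    have a2 := pos_of_mul_pos_right hgw ht.le
    have := hgf x y (by linarith) (by linarith)
    exact mul_pos ht (by linarith)
  have zero : ∀ w : M → ℝ, f w = 0 → g w = 0 → k w = 0 := by
    intro w hfw hgw
    have b1 := nonneg w hfw.ge hgw.ge
    have b2 := nonneg (-w) (by simp [hfw]) (by simp [hgw])
    rw [map_neg] at b2
    linarith
  by_cases hEq : f = g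
  · refine ⟨1 / 2, by norm_num, by norm_num, LinearMap.ext fun w ↦ ?_⟩
    have := zero (w - f w • x₁.1) (by simp [hf₁]) (by simp [hg₁, hEq])
    simp only [map_sub, map_smul, hk₁, smul_eq_mul, mul_one] at this
    simp only [LinearMap.add_apply, LinearMap.smul_apply, smul_eq_mul, ← hEq]
    linarith
  · obtain ⟨v, hv⟩ : ∃ v, f v ≠ g v := by
      by_contra! h; exact hEq (LinearMap.ext h)
    -- The vectors `d` and `x₁ - d` are dual to `f`, `g`, so the coefficients of `k` are its values
    -- there. They sum to `k x₁ = 1`, and strict Pareto makes both positive.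
    have hv' : f v - g v ≠ 0 := sub_ne_zero.2 hv
    set d := (f v - g v)⁻¹ • (v - g v • x₁.1) with hd
    have hfd : f d = 1 := by
      simp [hd, hf₁, hv']
    have hgd : g d = 0 := by
      simp [hd, hg₁]
    have c1 := pos₁ d (by rw [hfd]; exact one_pos) hgd.ge
    have c2 := pos₂ (x₁.1 - d) (by simp [hf₁, hfd]) (by simp [hg₁, hgd])
    rw [map_sub, hk₁] at c2
    refine ⟨k d, c1, by linarith, LinearMap.ext fun w ↦ ?_⟩
    have := zero (w - f w • d - g w • (x₁.1 - d)) (by simp [hf₁, hfd]) (by simp [hg₁, hgd])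
    simp only [map_sub, map_smul, hk₁, smul_eq_mul] at this
    simp only [LinearMap.add_apply, LinearMap.smul_apply, smul_eq_mul]
    linarith

end VNM


/-! ### Barycentric weights for set functions with values between those at the parts. -/

section Weights

variable {Ω V : Type*} [DecidableEq Ω] [AddCommGroup V] [Module ℝ V]

/-- The value of `F` at every union of two disjoint nonempty sets lies in the open segment between
the values at the two sets. -/
def IsBetween (F : Finset Ω → V) : Prop :=
  ∀ A B : Finset Ω, A.Nonempty → B.Nonempty → Disjoint A B →
    ∃ s : ℝ, 0 < s ∧ s < 1 ∧ F (A ∪ B) = s • F A + (1 - s) • F B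

/-- The value of `F` at `A` is the barycentre of its values at the points of `A`. -/
def IsBarycentre (F : Finset Ω → V) (p : Ω → ℝ) (A : Finset Ω) : Prop :=
  ∑ i ∈ A, p i • F {i} = (∑ i ∈ A, p i) • F A

/-- The value of `F` at `{i, j}` is the barycentre of its values at `i` and `j`, for the weights
`a` and `b`. -/
def PairBarycentre (F : Finset Ω → V) (i j : Ω) (a b : ℝ) : Prop :=
  a • F {i} + b • F {j} = (a + b) • F {i, j}

/-- Linear independence of three vectors. -/
def Indep3 (u v w : V) : Prop :=
  ∀ x y z : ℝ, x • u + y • v + z • w = 0 → x = 0 ∧ y = 0 ∧ z = 0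

theorem Indep3.rotate {u v w : V} (h : Indep3 u v w) : Indep3 v w u := by
  intro x y z hxyz
  obtain ⟨h1, h2, h3⟩ := h z x y (by rw [← hxyz]; abel)
  exact ⟨h2, h3, h1⟩

theorem Indep3.swap {u v w : V} (h : Indep3 u v w) : Indep3 v u w := by
  intro x y z hxyz
  obtain ⟨h1, h2, h3⟩ := h y x z (by rw [← hxyz]; abel)
  exact ⟨h2, h1, h3⟩

theorem Indep3.linearIndependent {u v w : V} (h : Indep3 u v w) :
    LinearIndependent ℝ ![u, v, w] := by
  rw [Fintype.linearIndependent_iff]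
  intro g hg i
  simp only [Fin.sum_univ_three, Matrix.cons_val_zero, Matrix.cons_val_one, Matrix.cons_val] at hg
  obtain ⟨h1, h2, h3⟩ := h _ _ _ hg
  fin_cases i <;> assumption

theorem Indep3.not_mem_span_pair {u v w : V} (h : Indep3 u v w) (a b : V)
    (hu : u ∈ Submodule.span ℝ {a, b}) (hv : v ∈ Submodule.span ℝ {a, b})
    (hw : w ∈ Submodule.span ℝ {a, b}) : False := by
  have hli := h.linearIndependent
  have hsub : Set.range ![u, v, w] ≤ Submodule.span ℝ (({a, b} : Set V)) := by
    rintro _ ⟨i, rfl⟩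
    fin_cases i <;> assumption
  classical
  have h1 := linearIndependent_le_span' _ hli ({a, b} : Set V) hsub
  have h2 : Fintype.card ({a, b} : Set V) ≤ 2 := by
    rw [← Set.toFinset_card]
    refine le_trans (Finset.card_le_card (t := {a, b}) ?_) Finset.card_le_two
    intro x; simp
  rw [Cardinal.mk_fin, Nat.cast_le] at h1
  omega

theorem indep3_of_not_mem_span (h : V →ₗ[ℝ] ℝ) {u v w : V} (hu : h u = 1) (hv : h v = 1)
    (huv : u ≠ v) (hw : w ∉ Submodule.span ℝ {u, v}) : Indep3 u v w := by
  intro x y z hxyz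
  have hz : z = 0 := by
    by_contra hz
    apply hw
    rw [Submodule.mem_span_pair]
    refine ⟨-(x / z), -(y / z), ?_⟩
    have : z • w = -(x • u) - y • v := by
      rw [eq_sub_iff_add_eq, eq_neg_iff_add_eq_zero, ← hxyz]; abel
    apply smul_right_injective V hz
    simp only [smul_add, smul_smul]
    rw [this]
    field_simp
    module
  subst hz
  have h1 : x + y = 0 := by
    have := congrArg h hxyz
    simpa [hu, hv] using this
  have hy : y = -x := by linarith
  subst hy
  have h2 : x • (u - v) = 0 := by rw [← hxyz]; module
  rcases smul_eq_zero.1 h2 with h3 | h3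
  · simp [h3]
  · exact absurd (sub_eq_zero.1 h3) huv

/-! ### Weights on pairs and triangles. -/

variable {F : Finset Ω → V} {h : V →ₗ[ℝ] ℝ}

theorem PairBarycentre.symm {i j : Ω} {a b : ℝ} (H : PairBarycentre F i j a b) :
    PairBarycentre F j i b a := by
  unfold PairBarycentre at *
  rw [add_comm, H, add_comm, Finset.pair_comm]

theorem IsBetween.pair (hS : IsBetween F) {i j : Ω} (hij : i ≠ j) :
    ∃ s : ℝ, 0 < s ∧ s < 1 ∧ F {i, j} = s • F {i} + (1 - s) • F {j} :=
  hS {i} {j} (by simp) (by simp) (by simpa using hij)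

theorem IsBetween.triple (hS : IsBetween F) {i j k : Ω} (hik : i ≠ k) (hjk : j ≠ k) :
    ∃ s : ℝ, 0 < s ∧ s < 1 ∧ F {i, j, k} = s • F {i, j} + (1 - s) • F {k} := by
  have := hS {i, j} {k} (by simp) (by simp) (by simp [hik.symm, hjk.symm])
  rwa [show ({i, j} ∪ {k} : Finset Ω) = {i, j, k} by ext; simp] at this

theorem pairBarycentre_of_eq (hS : IsBetween F) {i j : Ω} (hij : F {i} = F {j}) (a b : ℝ) :
    PairBarycentre F i j a b := by
  unfold PairBarycentre
  by_cases hne : i = j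
  · subst hne; simp [add_smul]
  · obtain ⟨s, -, -, hs⟩ := hS.pair hne
    rw [hs, hij]; module

theorem exists_pairBarycentre (hS : IsBetween F) {i j : Ω} (hij : i ≠ j) {b : ℝ} (hb : 0 < b) :
    ∃ a : ℝ, 0 < a ∧ PairBarycentre F i j a b := by
  obtain ⟨s, h0, h1, hs⟩ := hS.pair hij
  have h2 : 0 < 1 - s := by linarith
  refine ⟨s * b / (1 - s), by positivity, ?_⟩
  unfold PairBarycentre
  rw [hs]
  match_scalars
  · field_simp; ring
  · field_simp
    ring


omit [DecidableEq Ω] in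
theorem ne_of_indep3 {i j k : Ω} (hli : Indep3 (F {i}) (F {j}) (F {k})) :
    i ≠ j ∧ i ≠ k ∧ j ≠ k := by
  refine ⟨?_, ?_, ?_⟩ <;> rintro rfl
  · simpa using hli 1 (-1) 0 (by module)
  · simpa using hli 1 0 (-1) (by module)
  · simpa using hli 0 1 (-1) (by module)

theorem Indep3.coeff_eq {u v w : V} (hli : Indep3 u v w) {x y z x' y' z' : ℝ}
    (H : x • u + y • v + z • w = x' • u + y' • v + z' • w) : x = x' ∧ y = y' ∧ z = z' := by
  obtain ⟨h1, h2, h3⟩ := hli (x - x') (y - y') (z - z') (by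
    rw [← sub_eq_zero] at H; rw [← H]; module)
  exact ⟨by linarith, by linarith, by linarith⟩

/-- In a nondegenerate triangle, the pairs are barycentres with the weights with which the whole
triangle is. -/
theorem pairBarycentre_of_triple (hS : IsBetween F) {i j k : Ω}
    (hli : Indep3 (F {i}) (F {j}) (F {k})) {x y z : ℝ}
    (H : F {i, j, k} = x • F {i} + y • F {j} + z • F {k}) :
    PairBarycentre F i j x y := by
  obtain ⟨hij, hik, hjk⟩ := ne_of_indep3 hli
  obtain ⟨s, h0, h1, hs⟩ := hS.triple hik hjk
  obtain ⟨r, r0, r1, hr⟩ := hS.pair hij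
  rw [hs, hr] at H
  obtain ⟨e1, e2, e3⟩ := hli.coeff_eq (x := s * r) (y := s * (1 - r)) (z := 1 - s)
    (by rw [← H]; module)
  unfold PairBarycentre
  rw [hr, ← e1, ← e2]
  module

theorem exists_triple (hS : IsBetween F) {i j k : Ω} (hij : i ≠ j) (hik : i ≠ k) (hjk : j ≠ k) :
    ∃ x y z : ℝ, 0 < x ∧ 0 < y ∧ 0 < z ∧
      F {i, j, k} = x • F {i} + y • F {j} + z • F {k} := by
  obtain ⟨s, h0, h1, hs⟩ := hS.triple hik hjk
  obtain ⟨r, r0, r1, hr⟩ := hS.pair hij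
  exact ⟨s * r, s * (1 - r), 1 - s, by positivity, mul_pos h0 (by linarith), by linarith,
    by rw [hs, hr]; module⟩

theorem triple_rotate (i j k : Ω) : ({i, j, k} : Finset Ω) = {j, k, i} := by
  ext; simp; tauto

/-- Positive weights with which the three pairs in a nondegenerate triangle are barycentres. -/
theorem exists_weights_triple (hS : IsBetween F) {i j k : Ω}
    (hli : Indep3 (F {i}) (F {j}) (F {k})) :
    ∃ x y z : ℝ, 0 < x ∧ 0 < y ∧ 0 < z ∧ PairBarycentre F i j x y ∧ PairBarycentre F j k y z ∧
      PairBarycentre F k i z x := by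
  obtain ⟨hij, hik, hjk⟩ := ne_of_indep3 hli
  obtain ⟨x, y, z, hx, hy, hz, H⟩ := exists_triple hS hij hik hjk
  refine ⟨x, y, z, hx, hy, hz, pairBarycentre_of_triple hS hli H,
    pairBarycentre_of_triple hS (k := i) (z := x) hli.rotate ?_,
    pairBarycentre_of_triple hS (k := j) (z := y) hli.rotate.rotate ?_⟩
  · rw [← triple_rotate, H]; abel
  · rw [triple_rotate k, H]; abel

theorem PairBarycentre.mul_eq {i j : Ω} (hij : F {i} ≠ F {j}) {a b x y : ℝ}
    (H : PairBarycentre F i j a b) (H' : PairBarycentre F i j x y) : a * y = x * b := by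
  unfold PairBarycentre at *
  have h1 : (a * y - x * b) • (F {i} - F {j}) = 0 := by
    have e1 : (x + y) • (a • F {i} + b • F {j}) = (a + b) • (x • F {i} + y • F {j}) := by
      rw [H, H', smul_comm]
    rw [← sub_eq_zero] at e1
    rw [← e1]; module
  rcases smul_eq_zero.1 h1 with h3 | h3
  · linarith
  · exact absurd (sub_eq_zero.1 h3) hij

theorem PairBarycentre.scale {i j : Ω} {a b x y : ℝ} (hx : x ≠ 0)
    (H' : PairBarycentre F i j x y) (hab : a * y = x * b) : PairBarycentre F i j a b := by
  unfold PairBarycentre at *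
  have hb : b = a / x * y := by field_simp; linarith
  have : (a / x) • (x • F {i} + y • F {j}) = (a / x) • ((x + y) • F {i, j}) := by rw [H']
  simp only [smul_add, smul_smul] at this
  rw [hb]
  convert this using 2 <;> field_simp

/-- The triangle has weights `x, y, z` good for all three pairs. Since distinct points determine the
ratio of their weights, `a : b = x : y` and `b : c = y : z`, whence `a : c = x : z`. -/
theorem PairBarycentre.trans (hS : IsBetween F) {i j k : Ω}
    (hli : Indep3 (F {i}) (F {j}) (F {k})) {a b c : ℝ} (hb : 0 < b)
    (H : PairBarycentre F i j a b) (H' : PairBarycentre F j k b c) :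
    PairBarycentre F i k a c := by
  obtain ⟨x, y, z, hx, hy, hz, h1, h2, h3⟩ := exists_weights_triple hS hli
  have hij : F {i} ≠ F {j} := fun e ↦ by simpa using hli 1 (-1) 0 (by rw [e]; module)
  have hjk : F {j} ≠ F {k} := fun e ↦ by simpa using hli 0 1 (-1) (by rw [e]; module)
  have e1 := H.mul_eq hij h1
  have e2 := H'.mul_eq hjk h2
  refine h3.symm.scale hx.ne' ?_
  have : (b * y) * (a * z) = (b * y) * (x * c) := by
    linear_combination (b * z) * e1 + (x * b) * e2
  exact mul_left_cancel₀ (by positivity) this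

/-- The weight `q` is fixed by the pair with `t₁` and carried to `t₂` through the nondegenerate
triangle `i, t₁, t₂`. It reaches `t₃` through whichever of `t₁`, `t₂` forms a nondegenerate triangle
with `i` and `t₃`. -/
theorem exists_weight_aux (hS : IsBetween F) (hF : ∀ A : Finset Ω, A.Nonempty → h (F A) = 1)
    {t₁ t₂ t₃ : Ω} (hli : Indep3 (F {t₁}) (F {t₂}) (F {t₃})) {a b c : ℝ}
    (ha : 0 < a) (hb : 0 < b)
    (hab : PairBarycentre F t₁ t₂ a b) (hbc : PairBarycentre F t₂ t₃ b c)
    (hca : PairBarycentre F t₃ t₁ c a) {i : Ω}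
    (hi : F {i} ∉ Submodule.span ℝ {F {t₁}, F {t₂}}) :
    ∃ q : ℝ, 0 < q ∧ PairBarycentre F i t₁ q a ∧ PairBarycentre F i t₂ q b ∧
      PairBarycentre F i t₃ q c := by
  have h1 : ∀ j : Ω, h (F {j}) = 1 := fun j ↦ hF _ (by simp)
  have hne : ∀ {x y z : Ω}, Indep3 (F {x}) (F {y}) (F {z}) → F {x} ≠ F {y} := fun hl e ↦ by
    simpa using hl 1 (-1) 0 (by rw [e]; module)
  have hit : i ≠ t₁ := by
    rintro rfl; exact hi (Submodule.subset_span (by simp))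
  obtain ⟨q, hq, hq1⟩ := exists_pairBarycentre hS hit ha
  have hli2 : Indep3 (F {i}) (F {t₁}) (F {t₂}) :=
    (indep3_of_not_mem_span h (h1 _) (h1 _) (hne hli) hi).rotate.rotate
  have hq2 := hq1.trans hS hli2 ha hab
  refine ⟨q, hq, hq1, hq2, ?_⟩
  by_cases hA : F {i} ∈ Submodule.span ℝ {F {t₃}, F {t₁}}
  · by_cases hB : F {i} ∈ Submodule.span ℝ {F {t₂}, F {t₃}}
    -- Lying in both planes through `F {t₃}` and having `h = 1`, `F {i}` equals `F {t₃}`, so any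
    -- weights do.
    · apply pairBarycentre_of_eq hS
      rw [Submodule.mem_span_pair] at hA hB
      obtain ⟨x, y, hxy⟩ := hA
      obtain ⟨x', y', hxy'⟩ := hB
      obtain ⟨e1, -, -⟩ := hli.coeff_eq (x := y) (y := 0) (z := x) (x' := 0) (y' := x') (z' := y')
        (by rw [show (0 : ℝ) • F {t₁} + x' • F {t₂} + y' • F {t₃} = F {i} by rw [← hxy']; module,
              ← hxy]; module)
      subst e1
      have : x = 1 := by
        have := congrArg h hxy
        simpa [h1] using this
      rw [← hxy, this]; module
    · exact hq2.trans hS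
        (indep3_of_not_mem_span h (h1 _) (h1 _) (hne hli.rotate) hB).rotate.rotate hb hbc
  · exact hq1.trans hS
      (indep3_of_not_mem_span h (h1 _) (h1 _) (hne hli.rotate.rotate) hA).rotate.swap
      ha hca.symm

theorem exists_weights_pairs (hS : IsBetween F) (hF : ∀ A : Finset Ω, A.Nonempty → h (F A) = 1)
    {t₁ t₂ t₃ : Ω} (hli : Indep3 (F {t₁}) (F {t₂}) (F {t₃})) :
    ∃ p : Ω → ℝ, (∀ i, 0 < p i) ∧ ∀ i j, PairBarycentre F i j (p i) (p j) := by
  have h1 : ∀ j : Ω, h (F {j}) = 1 := fun j ↦ hF _ (by simp)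
  obtain ⟨a, b, c, ha, hb, hc, hab, hbc, hca⟩ := exists_weights_triple hS hli
  have key : ∀ i, ∃ q : ℝ, 0 < q ∧ PairBarycentre F i t₁ q a ∧ PairBarycentre F i t₂ q b ∧
      PairBarycentre F i t₃ q c := by
    intro i
    by_cases h3 : F {i} ∈ Submodule.span ℝ {F {t₁}, F {t₂}}
    · by_cases h2 : F {i} ∈ Submodule.span ℝ {F {t₂}, F {t₃}}
      · by_cases h4 : F {i} ∈ Submodule.span ℝ {F {t₃}, F {t₁}}
        -- A vector in all three coordinate planes has no nonzero coordinate, contrary to `h (F {i})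
        -- = 1`.
        · exfalso
          rw [Submodule.mem_span_pair] at h2 h3 h4
          obtain ⟨x, y, hxy⟩ := h3
          obtain ⟨x', y', hxy'⟩ := h2
          obtain ⟨x'', y'', hxy''⟩ := h4
          obtain ⟨e1, -, -⟩ := hli.coeff_eq (x := x) (y := y) (z := 0) (x' := 0) (y' := x')
            (z' := y') (by
              rw [show (0 : ℝ) • F {t₁} + x' • F {t₂} + y' • F {t₃} = F {i} by
                rw [← hxy']; module, ← hxy]; module)
          obtain ⟨-, e2, -⟩ := hli.coeff_eq (x := x) (y := y) (z := 0) (x' := y'') (y' := 0)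
            (z' := x'') (by
              rw [show y'' • F {t₁} + (0 : ℝ) • F {t₂} + x'' • F {t₃} = F {i} by
                rw [← hxy'']; module, ← hxy]; module)
          have := h1 i
          rw [← hxy, e1, e2] at this
          simp at this
        · obtain ⟨q, hq, q1, q2, q3⟩ :=
            exists_weight_aux hS hF hli.rotate.rotate hc ha hca hab hbc h4
          exact ⟨q, hq, q2, q3, q1⟩
      · obtain ⟨q, hq, q1, q2, q3⟩ := exists_weight_aux hS hF hli.rotate hb hc hbc hca hab h2
        exact ⟨q, hq, q3, q1, q2⟩
    · exact exists_weight_aux hS hF hli ha hb hab hbc hca h3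
  choose p hp p1 p2 p3 using key
  refine ⟨p, hp, fun i j ↦ ?_⟩
  by_cases hij : F {i} = F {j}
  · exact pairBarycentre_of_eq hS hij _ _
  -- Some reference point lies off the plane of `F {i}` and `F {j}`; the two weights are compared
  -- through it.
  have via : ∀ (k : Ω) (d : ℝ), 0 < d → F {k} ∉ Submodule.span ℝ {F {i}, F {j}} →
      PairBarycentre F i k (p i) d → PairBarycentre F j k (p j) d →
      PairBarycentre F i j (p i) (p j) := fun k d hd hk hi hj ↦
    hi.trans hS (indep3_of_not_mem_span h (h1 _) (h1 _) hij hk).rotate.swap.rotate.rotate hd hj.symm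
  by_cases k1 : F {t₁} ∈ Submodule.span ℝ {F {i}, F {j}}
  · by_cases k2 : F {t₂} ∈ Submodule.span ℝ {F {i}, F {j}}
    · by_cases k3 : F {t₃} ∈ Submodule.span ℝ {F {i}, F {j}}
      · exact (hli.not_mem_span_pair _ _ k1 k2 k3).elim
      · exact via t₃ c hc k3 (p3 i) (p3 j)
    · exact via t₂ b hb k2 (p2 i) (p2 j)
  · exact via t₁ a ha k1 (p1 i) (p1 j)

/-! ### From pairs to all sets, by induction on cardinality. -/

omit [DecidableEq Ω] in
theorem isBarycentre_of_smul (hF : ∀ A : Finset Ω, A.Nonempty → h (F A) = 1) {p : Ω → ℝ}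
    {A : Finset Ω} (hA : A.Nonempty) {c d : ℝ} (hc : c ≠ 0)
    (H : c • F A = d • ∑ i ∈ A, p i • F {i}) : IsBarycentre F p A := by
  have h1 := congrArg h H
  simp only [map_smul, map_sum, smul_eq_mul, hF A hA, hF {_} (Finset.singleton_nonempty _),
    mul_one] at h1
  have hd : d ≠ 0 := by rintro rfl; simp at h1; exact hc h1
  unfold IsBarycentre
  apply smul_right_injective V hd
  simp only [smul_smul]
  rw [← H, h1]

/-- Both `F A` and the weighted sum over `A` are combinations of the weighted sums over `B` and `A \
B`. If they are proportional, `h` forces `F A` to be the barycentre; otherwise the sum over `B` can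
be solved for. -/
theorem mem_span_of_not_isBarycentre (hS : IsBetween F)
    (hF : ∀ A : Finset Ω, A.Nonempty → h (F A) = 1) {p : Ω → ℝ} (hp : ∀ i, 0 < p i)
    {A B : Finset Ω} (hBA : B ⊆ A) (hB : B.Nonempty) (hC : (A \ B).Nonempty)
    (gB : IsBarycentre F p B) (gC : IsBarycentre F p (A \ B)) (hA : ¬ IsBarycentre F p A) :
    ∑ i ∈ B, p i • F {i} ∈ Submodule.span ℝ {F A, ∑ i ∈ A, p i • F {i}} := by
  obtain ⟨s, -, -, hs⟩ := hS B (A \ B) hB hC Finset.disjoint_sdiff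
  rw [Finset.union_sdiff_of_subset hBA] at hs
  have hpB : 0 < ∑ i ∈ B, p i := Finset.sum_pos (fun i _ ↦ hp i) hB
  have hpC : 0 < ∑ i ∈ A \ B, p i := Finset.sum_pos (fun i _ ↦ hp i) hC
  have hsum := Finset.sum_sdiff (f := fun i ↦ p i • F {i}) hBA
  unfold IsBarycentre at gB gC
  set b := ∑ i ∈ B, p i
  set c := ∑ i ∈ A \ B, p i
  set GB := ∑ i ∈ B, p i • F {i}
  set GC := ∑ i ∈ A \ B, p i • F {i}
  have eB : F B = b⁻¹ • GB := by rw [gB, inv_smul_smul₀ hpB.ne']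
  have eC : F (A \ B) = c⁻¹ • GC := by rw [gC, inv_smul_smul₀ hpC.ne']
  have key : F A - ((1 - s) * c⁻¹) • (∑ i ∈ A, p i • F {i}) = (s * b⁻¹ - (1 - s) * c⁻¹) • GB := by
    rw [hs, eB, eC, ← hsum]; module
  by_cases h0 : s * b⁻¹ - (1 - s) * c⁻¹ = 0
  · rw [h0, zero_smul, sub_eq_zero] at key
    exact absurd (isBarycentre_of_smul hF (hB.mono hBA) one_ne_zero (by rw [one_smul, key])) hA
  · rw [Submodule.mem_span_pair]
    refine ⟨(s * b⁻¹ - (1 - s) * c⁻¹)⁻¹,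
      -((s * b⁻¹ - (1 - s) * c⁻¹)⁻¹ * ((1 - s) * c⁻¹)), ?_⟩
    rw [← inv_smul_smul₀ h0 GB, ← key]
    module

theorem IsBetween.mem_span (hS : IsBetween F) {A : Finset Ω} (hA : A.Nonempty) :
    F A ∈ Submodule.span ℝ ((fun i ↦ F {i}) '' (A : Set Ω)) := by
  induction hA using Finset.Nonempty.cons_induction with
  | singleton a => exact Submodule.subset_span ⟨a, by simp⟩
  | cons a s ha hs ih =>
    obtain ⟨r, -, -, hr⟩ := hS {a} s (by simp) hs (by simpa using ha)
    rw [Finset.cons_eq_insert, Finset.insert_eq, hr]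
    refine Submodule.add_mem _ (Submodule.smul_mem _ _ (Submodule.subset_span ⟨a, by simp⟩))
      (Submodule.smul_mem _ _ (Submodule.span_mono (Set.image_mono ?_) ih))
    simp

theorem isBarycentre_of_const (hS : IsBetween F) {p : Ω → ℝ} {A : Finset Ω} (hA : A.Nonempty)
    {v : V} (hv : ∀ i ∈ A, F {i} = v) : IsBarycentre F p A := by
  have key : F A = v := by
    induction hA using Finset.Nonempty.cons_induction with
    | singleton a => exact hv a (by simp)
    | cons a s ha hs ih =>
      obtain ⟨r, -, -, hr⟩ := hS {a} s (by simp) hs (by simpa using ha)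
      rw [Finset.cons_eq_insert, Finset.insert_eq, hr, hv a (by simp),
        ih fun i hi ↦ hv i (by simp [hi])]
      module
  unfold IsBarycentre
  rw [key, Finset.sum_smul]
  exact Finset.sum_congr rfl fun i hi ↦ by rw [hv i hi]

omit [DecidableEq Ω] in
theorem isBarycentre_singleton (F : Finset Ω → V) (p : Ω → ℝ) (i : Ω) : IsBarycentre F p {i} := by
  simp [IsBarycentre]

theorem isBarycentre_of_card_le_two {p : Ω → ℝ}
    (hpair : ∀ i j, PairBarycentre F i j (p i) (p j)) {A : Finset Ω} (hA : A.Nonempty)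
    (hcard : A.card ≤ 2) : IsBarycentre F p A := by
  have h0 := hA.card_pos
  obtain h1 | h1 : A.card = 1 ∨ A.card = 2 := by omega
  · obtain ⟨i, rfl⟩ := Finset.card_eq_one.1 h1
    exact isBarycentre_singleton F p i
  · obtain ⟨i, j, hij, rfl⟩ := Finset.card_eq_two.1 h1
    unfold IsBarycentre
    rw [Finset.sum_pair hij, Finset.sum_pair hij]
    exact hpair i j

/-- If the sets with at least two fewer elements are barycentres, then the values of `F` at the
points of a set which is not lie in a plane. -/
theorem mem_span_of_card_add_two_le (hS : IsBetween F)
    (hF : ∀ A : Finset Ω, A.Nonempty → h (F A) = 1) {p : Ω → ℝ} (hp : ∀ i, 0 < p i)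
    {A : Finset Ω} (hcard : 4 ≤ A.card)
    (ih : ∀ B : Finset Ω, B.Nonempty → B.card + 2 ≤ A.card → IsBarycentre F p B)
    (hA : ¬ IsBarycentre F p A) {i : Ω} (hi : i ∈ A) :
    F {i} ∈ Submodule.span ℝ {F A, ∑ i ∈ A, p i • F {i}} := by
  set W := Submodule.span ℝ {F A, ∑ i ∈ A, p i • F {i}} with hW
  have hpairs : ∀ j ∈ A, ∀ l ∈ A, j ≠ l → p j • F {j} + p l • F {l} ∈ W := by
    intro j hj l hl hjl
    have hsub : ({j, l} : Finset Ω) ⊆ A := by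
      intro x; simp only [Finset.mem_insert, Finset.mem_singleton]; rintro (rfl | rfl) <;> assumption
    have hc : (A \ {j, l}).card + 2 = A.card := by
      rw [Finset.card_sdiff_of_subset hsub, Finset.card_pair hjl]; omega
    have hne : (A \ {j, l}).Nonempty := Finset.card_pos.1 (by omega)
    have := mem_span_of_not_isBarycentre hS hF hp hsub (by simp) hne
      (ih _ (by simp) (by rw [Finset.card_pair hjl]; omega)) (ih _ hne hc.le) hA
    rwa [Finset.sum_pair hjl] at this
  obtain ⟨j, hj, l, hl, hjl⟩ := Finset.one_lt_card.1 (show 1 < (A.erase i).card by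
    rw [Finset.card_erase_of_mem hi]; omega)
  rw [Finset.mem_erase] at hj hl
  have e1 := hpairs i hi j hj.2 hj.1.symm
  have e2 := hpairs i hi l hl.2 hl.1.symm
  have e3 := hpairs j hj.2 l hl.2 hjl
  -- Adding the pair sums for `i, j` and `i, l` and subtracting that for `j, l` leaves `2 * p i`
  -- times `F {i}`.
  have e4 := W.smul_mem ((2 * p i)⁻¹) (W.sub_mem (W.add_mem e1 e2) e3)
  have hpi := (hp i).ne'
  convert e4 using 1
  match_scalars <;> field_simp <;> ring

/-- A set function with values between those at the parts, three of whose values at points are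
linearly independent, is the barycentre of its values at points, for positive weights. -/
theorem exists_weights (hS : IsBetween F) (hF : ∀ A : Finset Ω, A.Nonempty → h (F A) = 1)
    {t₁ t₂ t₃ : Ω} (hli : Indep3 (F {t₁}) (F {t₂}) (F {t₃})) :
    ∃ p : Ω → ℝ, (∀ i, 0 < p i) ∧ ∀ A : Finset Ω, A.Nonempty → IsBarycentre F p A := by
  have h1 : ∀ j : Ω, h (F {j}) = 1 := fun j ↦ hF _ (by simp)
  obtain ⟨p, hp, hpair⟩ := exists_weights_pairs hS hF hli
  refine ⟨p, hp, fun A hne ↦ ?_⟩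
  induction hn : A.card using Nat.strong_induction_on generalizing A with
  | _ n ih =>
  have ih' : ∀ B : Finset Ω, B.Nonempty → B.card < A.card → IsBarycentre F p B :=
    fun B hB hlt ↦ ih _ (hn ▸ hlt) B hB rfl
  by_cases h2 : A.card ≤ 2
  · exact isBarycentre_of_card_le_two hpair hne h2
  by_cases hconst : ∀ i ∈ A, ∀ j ∈ A, F {i} = F {j}
  · obtain ⟨j, hj⟩ := hne
    exact isBarycentre_of_const hS ⟨j, hj⟩ fun i hi ↦ hconst i hi j hj
  push Not at hconst
  obtain ⟨i, hi, j, hj, hij⟩ := hconst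
  by_cases hk : ∃ k, F {k} ∉ Submodule.span ℝ ((fun i ↦ F {i}) '' (A : Set Ω))
  · obtain ⟨k, hk⟩ := hk
    have hmem : ∀ l ∈ A, F {l} ∈ Submodule.span ℝ ((fun i ↦ F {i}) '' (A : Set Ω)) :=
      fun l hl ↦ Submodule.subset_span ⟨l, hl, rfl⟩
    have hkA : k ∉ A := fun h' ↦ hk (hmem k h')
    have hind : Indep3 (F {i}) (F {j}) (F {k}) := by
      refine indep3_of_not_mem_span h (h1 _) (h1 _) hij fun h' ↦ hk (Submodule.span_le.2 ?_ h')
      rintro _ (rfl | rfl)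
      exacts [hmem i hi, hmem j hj]
    -- The induction runs through the larger set `insert k A`: a pair and its complement there are
    -- both smaller than `A`, so failure would put the independent vectors at `i`, `j`, `k` in a
    -- plane.
    have hgood : IsBarycentre F p (insert k A) := by
      by_contra hbad
      have hc : (insert k A).card = A.card + 1 := Finset.card_insert_of_notMem hkA
      have := fun l hl ↦ mem_span_of_card_add_two_le hS hF hp (A := insert k A) (by omega)
        (fun B hB hle ↦ ih' B hB (by omega)) hbad (i := l) hl
      exact hind.not_mem_span_pair _ _ (this i (by simp [hi])) (this j (by simp [hj]))
        (this k (by simp))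
    obtain ⟨s, s0, s1, hs⟩ := hS A {k} hne (by simp) (by simpa using hkA)
    unfold IsBarycentre at hgood
    rw [Finset.sum_insert hkA, Finset.sum_insert hkA, Finset.insert_eq, Finset.union_comm, hs]
      at hgood
    have hpA : 0 < ∑ i ∈ A, p i := Finset.sum_pos (fun i _ ↦ hp i) hne
    have hpk := hp k
    set P := p k + ∑ i ∈ A, p i
    set G := ∑ i ∈ A, p i • F {i} with hG
    have hP : 0 < P := add_pos hpk hpA
    have hFA := hS.mem_span hne
    have hGm : G ∈ Submodule.span ℝ ((fun i ↦ F {i}) '' (A : Set Ω)) :=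
      Submodule.sum_mem _ fun l hl ↦ Submodule.smul_mem _ _ (hmem l hl)
    -- The left side lies in the span of the point values on `A` and `F {k}` does not, so both sides
    -- vanish and `F A` is proportional to `G`.
    have e1 : (P * s) • F A - G = (p k - P * (1 - s)) • F {k} := by
      rw [sub_eq_iff_eq_add, ← sub_eq_zero]
      rw [← sub_eq_zero] at hgood
      rw [← neg_eq_zero, ← hgood]; module
    have e2 : p k - P * (1 - s) = 0 := by
      by_contra h0
      apply hk
      have := Submodule.smul_mem _ (p k - P * (1 - s))⁻¹
        (Submodule.sub_mem _ (Submodule.smul_mem _ (P * s) hFA) hGm)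
      rwa [e1, inv_smul_smul₀ h0] at this
    rw [e2, zero_smul, sub_eq_zero] at e1
    exact isBarycentre_of_smul hF hne (mul_pos hP s0).ne' (d := 1) (by rw [e1, one_smul])
  -- Here `A` spans all point values. If `A` failed, splitting off each single point would put them
  -- all in a plane.
  · push Not at hk
    by_contra hbad
    have hin : ∀ l ∈ A, F {l} ∈ Submodule.span ℝ {F A, ∑ i ∈ A, p i • F {i}} := by
      intro l hl
      have hc : (A \ {l}).card + 1 = A.card := by
        rw [Finset.sdiff_singleton_eq_erase]; exact Finset.card_erase_add_one hl
      have hne' : (A \ {l}).Nonempty := Finset.card_pos.1 (by omega)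
      have := mem_span_of_not_isBarycentre hS hF hp (Finset.singleton_subset_iff.2 hl) (by simp)
        hne' (isBarycentre_singleton F p l) (ih' _ hne' (by omega)) hbad
      rw [Finset.sum_singleton] at this
      have := Submodule.smul_mem _ (p l)⁻¹ this
      rwa [inv_smul_smul₀ (hp l).ne'] at this
    have hle : Submodule.span ℝ ((fun i ↦ F {i}) '' (A : Set Ω)) ≤
        Submodule.span ℝ {F A, ∑ i ∈ A, p i • F {i}} := by
      rw [Submodule.span_le]
      rintro _ ⟨l, hl, rfl⟩
      exact hin l hl
    exact hli.not_mem_span_pair _ _ (hle (hk _)) (hle (hk _)) (hle (hk _))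

end Weights


/-! ### Linear independence from richness. -/

theorem eq_zero_of_isolated_sign {a b c x y z : ℝ} (ha : 0 < a) (hb : b ≤ 0) (hc : c ≤ 0)
    (hx : 0 ≤ x) (hy : y ≤ 0) (hz : z ≤ 0) (hsum : x + y + z = 0)
    (H : x * a + y * b + z * c = 0) : x = 0 ∧ y = 0 ∧ z = 0 := by
  have h1 : 0 ≤ x * a := by positivity
  have h2 := mul_nonneg_of_nonpos_of_nonpos hy hb
  have h3 := mul_nonneg_of_nonpos_of_nonpos hz hc
  have h4 : x * a = 0 := by linarith
  have h5 : x = 0 := (mul_eq_zero.1 h4).resolve_right ha.ne'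
  exact ⟨h5, by linarith, by linarith⟩

/-- Three normalized functionals, none of which is in the convex cone generated by the other two,
are linearly independent. -/
theorem indep3_of_isolated {E : Type*} [AddCommGroup E] [Module ℝ E] {f₁ f₂ f₃ : E →ₗ[ℝ] ℝ}
    {e d₁ d₂ d₃ : E} (h₁ : f₁ e = 1) (h₂ : f₂ e = 1) (h₃ : f₃ e = 1)
    (hd₁ : 0 < f₁ d₁ ∧ f₂ d₁ ≤ 0 ∧ f₃ d₁ ≤ 0) (hd₂ : 0 < f₂ d₂ ∧ f₁ d₂ ≤ 0 ∧ f₃ d₂ ≤ 0)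
    (hd₃ : 0 < f₃ d₃ ∧ f₁ d₃ ≤ 0 ∧ f₂ d₃ ≤ 0) : Indep3 f₁ f₂ f₃ := by
  have key : ∀ {f g k : E →ₗ[ℝ] ℝ} {d : E}, f e = 1 → g e = 1 → k e = 1 →
      (0 < f d ∧ g d ≤ 0 ∧ k d ≤ 0) → ∀ x y z : ℝ, x • f + y • g + z • k = 0 →
      0 ≤ x → y ≤ 0 → z ≤ 0 → x = 0 ∧ y = 0 ∧ z = 0 := by
    intro f g k d hf hg hk ⟨a, b, c⟩ x y z H hx hy hz
    refine eq_zero_of_isolated_sign a b c hx hy hz ?_ ?_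
    · have := LinearMap.congr_fun H e
      simpa [hf, hg, hk] using this
    · simpa using LinearMap.congr_fun H d
  -- Up to negation, a linear relation has at most one positive coefficient. Evaluated at the
  -- direction isolating that functional it is a sum of nonnegative terms; evaluated at `e` it says
  -- that the coefficients sum to zero.
  have half : ∀ x y z : ℝ, x • f₁ + y • f₂ + z • f₃ = 0 → (0 ≤ x ∧ y ≤ 0 ∧ z ≤ 0) ∨
      (x ≤ 0 ∧ 0 ≤ y ∧ z ≤ 0) ∨ (x ≤ 0 ∧ y ≤ 0 ∧ 0 ≤ z) ∨ (x ≤ 0 ∧ y ≤ 0 ∧ z ≤ 0) →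
      x = 0 ∧ y = 0 ∧ z = 0 := by
    rintro x y z H (⟨hx, hy, hz⟩ | ⟨hx, hy, hz⟩ | ⟨hx, hy, hz⟩ | ⟨hx, hy, hz⟩)
    · exact key h₁ h₂ h₃ hd₁ x y z H hx hy hz
    · obtain ⟨a, b, c⟩ := key h₂ h₁ h₃ hd₂ y x z (by rw [← H]; abel) hy hx hz
      exact ⟨b, a, c⟩
    · obtain ⟨a, b, c⟩ := key h₃ h₁ h₂ hd₃ z x y (by rw [← H]; abel) hz hx hy
      exact ⟨b, c, a⟩
    · have := LinearMap.congr_fun H e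
      simp only [LinearMap.add_apply, LinearMap.smul_apply, h₁, h₂, h₃, smul_eq_mul, mul_one,
        LinearMap.zero_apply] at this
      exact ⟨by linarith, by linarith, by linarith⟩
  intro x y z H
  have neg : (0 ≤ -x ∧ -y ≤ 0 ∧ -z ≤ 0) ∨ (-x ≤ 0 ∧ 0 ≤ -y ∧ -z ≤ 0) ∨
      (-x ≤ 0 ∧ -y ≤ 0 ∧ 0 ≤ -z) ∨ (-x ≤ 0 ∧ -y ≤ 0 ∧ -z ≤ 0) → x = 0 ∧ y = 0 ∧ z = 0 :=
    fun h ↦ by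
      obtain ⟨a, b, c⟩ := half (-x) (-y) (-z) (by rw [← neg_eq_zero, ← H]; module) h
      exact ⟨neg_eq_zero.1 a, neg_eq_zero.1 b, neg_eq_zero.1 c⟩
  simp only [Left.nonneg_neg_iff, Left.neg_nonpos_iff] at neg
  have pos := half x y z H
  rcases le_total x 0 with hx | hx <;> rcases le_total y 0 with hy | hy <;>
    rcases le_total z 0 with hz | hz
  · exact pos (.inr (.inr (.inr ⟨hx, hy, hz⟩)))
  · exact pos (.inr (.inr (.inl ⟨hx, hy, hz⟩)))
  · exact pos (.inr (.inl ⟨hx, hy, hz⟩))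
  · exact neg (.inl ⟨hx, hy, hz⟩)
  · exact pos (.inl ⟨hx, hy, hz⟩)
  · exact neg (.inr (.inl ⟨hx, hy, hz⟩))
  · exact neg (.inr (.inr (.inl ⟨hx, hy, hz⟩)))
  · exact neg (.inr (.inr (.inr ⟨hx, hy, hz⟩)))

/-! ### Assembling the representation. -/

variable {Ω M : Type*} [DecidableEq Ω] [Fintype M] {R : CondAct Ω M → CondAct Ω M → Prop}

/-- A strict preference in every state is a strict preference given every event. -/
theorem ExtendedPareto.sPref (hP : ExtendedPareto R) {x y : Lottery M}
    (hxy : ∀ ω : Ω, SPref R (Event.single ω) x y) (A : Finset Ω) (hA : A.Nonempty) :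
    SPref R ⟨A, hA⟩ x y := by
  induction hA using Finset.Nonempty.cons_induction with
  | singleton a => exact hxy a
  | cons a s ha hs ih =>
    have := (hP (Event.single a) ⟨s, hs⟩ (by simpa [Event.single] using ha) x y).2 (hxy a) ih.1
    have e : Event.union (Event.single a) ⟨s, hs⟩ = ⟨Finset.cons a s ha, by simp⟩ :=
      Subtype.ext (Finset.cons_eq_insert a s ha).symm
    rwa [e] at this

theorem expUtil_eq (f : (M → ℝ) →ₗ[ℝ] ℝ) (x : Lottery M) [DecidableEq M] :
    expUtil x (fun m ↦ f (Pi.single m 1)) = f x.1 := by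
  rw [LinearMap.pi_apply_eq_sum_univ f x.1, expUtil]
  refine Finset.sum_congr rfl fun m _ ↦ ?_
  rw [smul_eq_mul]
  congr 3
  funext j
  simp [Pi.single_apply, eq_comm]

theorem condProb_div (p : Ω → ℝ) {c : ℝ} (hc : c ≠ 0) (A : Event Ω) {ω : Ω} (hω : ω ∈ A.1) :
    condProb (fun ω ↦ p ω / c) A ω = p ω / ∑ ω' ∈ A.1, p ω' := by
  rw [condProb, Finset.singleton_inter_of_mem hω, Finset.sum_singleton, ← Finset.sum_div,
    div_div_div_cancel_right₀ hc]

end CondSEU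

theorem theorem7 {Ω M : Type*} [Fintype Ω] [DecidableEq Ω] [Fintype M]
    (R : CondSEU.CondAct Ω M → CondSEU.CondAct Ω M → Prop)
    (hWO : CondSEU.WeakOrder R)
    (hCont : CondSEU.VNMContinuity R)
    (hInd : CondSEU.Independence R)
    (hPareto : CondSEU.ExtendedPareto R)
    (hMA : CondSEU.MinimalAgreement R)
    (hRich : CondSEU.Richness R) :
    ∃ (u : Ω → M → ℝ) (P : Ω → ℝ),
      (∀ ω, 0 < P ω) ∧ ∑ ω, P ω = 1 ∧
      ∀ (x y : CondSEU.Lottery M) (A : CondSEU.Event Ω),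
        CondSEU.Pref R A x y ↔
          CondSEU.condExpUtil P u A y ≤ CondSEU.condExpUtil P u A x := by
  classical
  open CondSEU in
  obtain ⟨x₁, x₀, hx⟩ := hMA
  have hvnm : ∀ A : Finset Ω, ∃ g : (M → ℝ) →ₗ[ℝ] ℝ, ∀ hA : A.Nonempty, g x₀.1 = 0 ∧
      g x₁.1 = 1 ∧ ∀ x y, Pref R ⟨A, hA⟩ x y ↔ g y.1 ≤ g x.1 := by
    intro A
    by_cases hA : A.Nonempty
    · obtain ⟨g, hg⟩ := exists_expected_utility (Q := Pref R ⟨A, hA⟩) (hWO ⟨A, hA⟩).1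
        (hWO ⟨A, hA⟩).2
        (fun x y z hxy hyz ↦ by
          obtain ⟨α, -, h, -⟩ := hCont ⟨A, hA⟩ x y z hxy hyz
          exact ⟨α, h⟩)
        (hInd ⟨A, hA⟩) (hPareto.sPref hx A hA).2
      exact ⟨g, fun _ ↦ hg⟩
    · exact ⟨0, fun h ↦ absurd h hA⟩
  choose F hF₀ hF₁ hF using hvnm
  have hstrict : ∀ A (hA : A.Nonempty) x y, SPref R ⟨A, hA⟩ x y ↔ F A y.1 < F A x.1 := by
    intro A hA x y
    rw [SPref, hF, hF, not_le]
    exact ⟨fun h ↦ h.2, fun h ↦ ⟨h.le, h⟩⟩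
  have hS : IsBetween F := by
    intro A B hA hB hAB
    have hBA : Event.union ⟨B, hB⟩ ⟨A, hA⟩ = Event.union ⟨A, hA⟩ ⟨B, hB⟩ :=
      Subtype.ext (Finset.union_comm _ _)
    have hU : (A ∪ B).Nonempty := hA.mono Finset.subset_union_left
    refine exists_convex_combination (x₁ := x₁) (x₀ := x₀) (hF₀ A hA) (hF₀ B hB) (hF₀ _ hU)
      (hF₁ A hA) (hF₁ B hB) (hF₁ _ hU) (fun x y h h' ↦ ?_) (fun x y h h' ↦ ?_) fun x y h h' ↦ ?_
    · rw [← hF _ hU]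
      exact (hPareto ⟨A, hA⟩ ⟨B, hB⟩ hAB x y).1 ((hF A hA x y).2 h) ((hF B hB x y).2 h')
    · rw [← hstrict _ hU]
      exact (hPareto ⟨A, hA⟩ ⟨B, hB⟩ hAB x y).2 ((hstrict A hA x y).2 h) ((hF B hB x y).2 h')
    · rw [← hstrict _ hU]
      have := (hPareto ⟨B, hB⟩ ⟨A, hA⟩ hAB.symm x y).2 ((hstrict B hB x y).2 h')
        ((hF A hA x y).2 h)
      rwa [hBA] at this
  -- Evaluation at `x₁` is the functional equal to 1 on every `F A`.
  let e : ((M → ℝ) →ₗ[ℝ] ℝ) →ₗ[ℝ] ℝ := LinearMap.applyₗ x₁.1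
  obtain ⟨T, hT, hrich⟩ := hRich
  obtain ⟨t₁, t₂, t₃, h12, h13, h23, rfl⟩ := Finset.card_eq_three.1 hT
  have hone : ∀ ω, ({ω} : Finset Ω).Nonempty := Finset.singleton_nonempty
  have hli : Indep3 (F {t₁}) (F {t₂}) (F {t₃}) := by
    have dir : ∀ a b c : Ω, a ≠ b → a ≠ c → ({t₁, t₂, t₃} : Finset Ω) = {a, b, c} →
        ∃ d, 0 < F {a} d ∧ F {b} d ≤ 0 ∧ F {c} d ≤ 0 := by
      intro a b c hab hac hT'
      rw [hT'] at hrich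
      obtain ⟨x, y, hxy, h⟩ := hrich a (by simp)
      refine ⟨x.1 - y.1, ?_, ?_, ?_⟩
      · rw [map_sub, sub_pos]
        exact (hstrict _ (hone a) x y).1 hxy
      · rw [map_sub, sub_nonpos]
        exact (hF _ (hone b) y x).1 (h b (by simp [hab.symm]))
      · rw [map_sub, sub_nonpos]
        exact (hF _ (hone c) y x).1 (h c (by simp [hac.symm]))
    obtain ⟨d₁, hd₁⟩ := dir t₁ t₂ t₃ h12 h13 rfl
    obtain ⟨d₂, hd₂⟩ := dir t₂ t₁ t₃ h12.symm h23 (by ext; simp; tauto)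
    obtain ⟨d₃, hd₃⟩ := dir t₃ t₁ t₂ h13.symm h23.symm (by ext; simp; tauto)
    exact indep3_of_isolated (hF₁ _ (hone t₁)) (hF₁ _ (hone t₂)) (hF₁ _ (hone t₃)) hd₁ hd₂ hd₃
  obtain ⟨p, hp, hbar⟩ := exists_weights (h := e) hS (fun A hA ↦ hF₁ A hA) hli
  have hpos : 0 < ∑ ω, p ω := Finset.sum_pos (fun ω _ ↦ hp ω) ⟨t₁, Finset.mem_univ _⟩
  refine ⟨fun ω m ↦ F {ω} (Pi.single m 1), fun ω ↦ p ω / ∑ ω, p ω, fun ω ↦ div_pos (hp ω) hpos,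
    by rw [← Finset.sum_div, div_self hpos.ne'], fun x y A ↦ ?_⟩
  -- Conditioning cancels the normalization of `p`, so the barycentre identity evaluated at `x` is
  -- the claim.
  have hval : ∀ x : Lottery M, condExpUtil (fun ω ↦ p ω / ∑ ω, p ω)
      (fun ω m ↦ F {ω} (Pi.single m 1)) A x = F A.1 x.1 := by
    intro x
    have hA : 0 < ∑ ω ∈ A.1, p ω := Finset.sum_pos (fun ω _ ↦ hp ω) A.2
    have hb := LinearMap.congr_fun (hbar A.1 A.2) x.1
    simp only [LinearMap.sum_apply, LinearMap.smul_apply, smul_eq_mul] at hb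
    rw [condExpUtil, ← mul_right_inj' hA.ne', ← hb, Finset.mul_sum]
    refine Finset.sum_congr rfl fun ω hω ↦ ?_
    rw [condProb_div p hpos.ne' A hω, expUtil_eq]
    field_simp
  rw [hval, hval]
  exact hF A.1 A.2 x y
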